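/- Let $n\ge 1$, $m\ge 0$, $A\in\mathbb R^{n\times n}$, $B\in\mathbb R^{n\times m}$, $C\in\mathbb R^{m\times n}$, $D\in\mathbb R^{m\times m}$, and let $\mathbb R[x,w,\lambda]$ be the polynomial ring in $x_1,\dots,x_n,w_1,\dots,w_m,\lambda$. Write $\|(x,w)\|^2=\sum_i x_i^2+\sum_j w_j^2$. Let $E$ be the set of the $n+m+1$ polynomials $(Ax+Bw-\lambda x)_i$ $(1\le i\le n)$, $w_j(Cx+Dw-w)_j$ $(1\le j\le m)$ and $\|(x,w)\|^2-1$, let $I$ be the ideal generated by $E$, and let $$G=\{\,w_iw_j,\ \ w_j(w-(Cx+Dw))_i,\ \ (w-(Cx+Dw))_i\,(w-(Cx+Dw))_j \;:\; 1\le i,j\le m\,\}.$$ Let $S\subset\mathbb R^{n+m+1}$ be the set of real points at which all $e\in E$ vanish and all $g\in G$ are nonnegative, and let $S_+=S\cap\{\lambda\ge 0\}$. For $N\in\mathbb N$ put $$\mathcal B_N=\{\lambda^k,\lambda^kx_i,\lambda^kw_j: 0\le k\le N,\ 1\le i\le n,\ 1\le j\le m\},\qquad \mathcal B_N^-=\{\lambda^kx_i,\lambda^kw_j: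 0\le k\le N,\ 1\le i\le n,\ 1\le j\le m\}.$$ A polynomial is supported on a set of monomials if it is a real linear combination of them. Assume that $I$ is zero-dimensional (its complex variety is finite), is radical, and has a reduced Gröbner basis for the lexicographic order with $\lambda<x_1<\dots<x_n<w_1<\dots<w_m$ of the form $$\{u_0,\ x_1^2-u_1,\ x_2-u_2x_1,\dots,x_n-u_nx_1,\ w_1-v_1x_1,\dots,w_m-v_mx_1\},\qquad u_i,v_j\in\mathbb R[\lambda].$$ Let $f\in\mathbb R[x,w,\lambda]$ be homogeneous of degree $2$ in $(x,w)$ (its coefficients may be polynomials in $\lambda$), and let $f^{\min}$ be the minimum of $f$ on $S_+$, or the minimum of $f$ on $S$ (the claim holds for either choice, provided that the set in question is nonempty). For $d\ge 2$ and $N\in\mathbb N$, call $(d,N)$ admissible if there is an identity $$f-f^{\min}\|(x,w)\|^2=\sum_\ell u_{0,\ell}^2+\lambda\sum_\ell u_{\lambda,\ell}^2+\sum_{g\in G}g\sum_\ell u_{g,\ell}^2+p\cdot(Ax+Bw-\lambda x)+q\cdot \big(w\odot(Cx+Dw-w)\big)+r\,(\|(x,w)\|^2-1)$$ with finite sums,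 all $u_{0,\ell},u_{\lambda,\ell},u_{g,\ell}$ supported on $\mathcal B_N$, and polynomials $p_i$ of total degree at most $2d-1$ and $q_j,r$ of total degree at most $2d-2$. Then admissible pairs $(d,N)$ with $d\ge2$ exist, and for every admissible pair $(d,N)$ with $d\ge 2$ there are finite sequences of polynomials $(v_{0,\ell})_\ell,(v_{\lambda,\ell})_\ell,(v_{g,\ell})_\ell$ supported on $\mathcal B_N^-$, polynomials $p_i$ $(1\le i\le n)$ homogeneous of degree $2d-1$ in $(x,w)$, and polynomials $q_j$ $(1\le j\le m)$ homogeneous of degree $2d-2$ in $(x,w)$, such that $$\|(x,w)\|^{2d-2}\big(f-f^{\min}\|(x,w)\|^2\big)=\|(x,w)\|^{2d-2}\Big(\sum_\ell v_{0,\ell}^2+\lambda\sum_\ell v_{\lambda,\ell}^2\Big)+\|(x,w)\|^{2d-4}\sum_{g\in G}g\sum_\ell v_{g,\ell}^2+p\cdot(Ax+Bw-\lambda x)+q\cdot \big(w\odot(Cx+Dw-w)\big).$$ -/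

import Mathlib

open MvPolynomial

noncomputable section

namespace ReLUSparse

/-- The `n + m + 1` variables `x₁, …, xₙ`, `w₁, …, wₘ`, `λ`. -/
inductive Var (n m : ℕ) : Type
  | x (i : Fin n) : Var n m
  | w (j : Fin m) : Var n m
  | lam : Var n m

namespace Var

variable {n m : ℕ}

/-- Position of a variable in the list `wₘ, …, w₁, xₙ, …, x₁, λ`. -/
def rank : Var n m → ℕ
  | w j => (Fin.rev j : ℕ)
  | x i => m + (Fin.rev i : ℕ)
  | lam => m + n

theorem rank_injective : Function.Injective (rank : Var n m → ℕ) := by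
  intro a b h
  cases a with
  | x i =>
    cases b with
    | x i' => congr 1; ext; simp only [rank, Fin.val_rev] at h; omega
    | w j => simp only [rank, Fin.val_rev] at h; omega
    | lam => simp only [rank, Fin.val_rev] at h; omega
  | w j =>
    cases b with
    | x i' => simp only [rank, Fin.val_rev] at h; omega
    | w j' => congr 1; ext; simp only [rank, Fin.val_rev] at h; omega
    | lam => simp only [rank, Fin.val_rev] at h; omega
  | lam =>
    cases b with
    | x i' => simp only [rank, Fin.val_rev] at h; omega
    | w j => simp only [rank, Fin.val_rev] at h; omega
    | lam => rfl

instance instLinearOrder : LinearOrder (Var n m) := LinearOrder.lift' rank rank_injective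

theorem rank_le (a : Var n m) : rank a ≤ m + n := by
  cases a <;> simp only [rank, Fin.val_rev] <;> omega

instance instFinite : Finite (Var n m) :=
  Finite.of_injective (fun a : Var n m => (⟨rank a, Nat.lt_succ_of_le (rank_le a)⟩ : Fin (m + n + 1)))
    fun _ _ h => rank_injective (Fin.mk.inj h)

end Var

/-- The polynomial ring `ℝ[x, w, λ]`. -/
abbrev Poly (n m : ℕ) : Type := MvPolynomial (Var n m) ℝ

/-- The lexicographic order with `λ < x₁ < ⋯ < xₙ < w₁ < ⋯ < wₘ`. In `MonomialOrder.lex` a smaller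
index is a larger variable, and the variables are indexed in the order `wₘ, …, w₁, xₙ, …, x₁, λ`. -/
def lexOrder (n m : ℕ) : MonomialOrder (Var n m) := MonomialOrder.lex

section System

variable {n m : ℕ} (A : Matrix (Fin n) (Fin n) ℝ) (B : Matrix (Fin n) (Fin m) ℝ)
  (C : Matrix (Fin m) (Fin n) ℝ) (D : Matrix (Fin m) (Fin m) ℝ)

/-- The variable `xᵢ`. -/
def px (i : Fin n) : Poly n m := X (Var.x i)

/-- The variable `wⱼ`. -/
def pw (j : Fin m) : Poly n m := X (Var.w j)

/-- The variable `λ`. -/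
def pl : Poly n m := X Var.lam

/-- `‖(x, w)‖² = ∑ xᵢ² + ∑ wⱼ²`. -/
def normSq : Poly n m := ∑ i, px i ^ 2 + ∑ j, pw j ^ 2

/-- `(A x + B w - λ x)ᵢ`. -/
def linEq (i : Fin n) : Poly n m :=
  ∑ k, MvPolynomial.C (A i k) * px k + ∑ j, MvPolynomial.C (B i j) * pw j - pl * px i

/-- `(C x + D w)ⱼ`. -/
def relIn (j : Fin m) : Poly n m :=
  ∑ k, MvPolynomial.C (C j k) * px k + ∑ l, MvPolynomial.C (D j l) * pw l

/-- `wⱼ (C x + D w - w)ⱼ`. -/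
def reluEq (j : Fin m) : Poly n m := pw j * (relIn C D j - pw j)

/-- The set `E` of the equality constraints, including the unit sphere constraint. -/
def eqs : Set (Poly n m) :=
  Set.range (linEq A B) ∪ Set.range (reluEq C D) ∪ {normSq - 1}

/-- The ideal `I` generated by `E`. -/
def eqIdeal : Ideal (Poly n m) := Ideal.span (eqs A B C D)

open Classical in
/-- The finite set `G` of the quadratic inequality constraints: all `wᵢ wⱼ`,
`wⱼ (w - (C x + D w))ᵢ` and `(w - (C x + D w))ᵢ (w - (C x + D w))ⱼ`. -/
def ineqs : Finset (Poly n m) :=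
  Finset.univ.image (fun t : Fin m × Fin m => pw t.1 * pw t.2) ∪
  Finset.univ.image (fun t : Fin m × Fin m => pw t.2 * (pw t.1 - relIn C D t.1)) ∪
  Finset.univ.image (fun t : Fin m × Fin m =>
    (pw t.1 - relIn C D t.1) * (pw t.2 - relIn C D t.2))

/-- The real points at which every `e ∈ E` vanishes and every `g ∈ G` is nonnegative. -/
def solSet : Set (Var n m → ℝ) :=
  {z | (∀ g ∈ ineqs C D, 0 ≤ eval z g) ∧ ∀ e ∈ eqs A B C D, eval z e = 0}

/-- The points of `solSet` with `λ ≥ 0`. -/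
def feasibleSet : Set (Var n m → ℝ) := {z | z ∈ solSet A B C D ∧ 0 ≤ z Var.lam}

end System

/-- `𝒢` is a reduced Gröbner basis of `J`. For exponent vectors over a field, `a ≤ b` says that the
monomial with exponents `a` divides the one with exponents `b`. -/
structure IsReducedGroebnerBasis {σ : Type*} (ord : MonomialOrder σ)
    (𝒢 : Set (MvPolynomial σ ℝ)) (J : Ideal (MvPolynomial σ ℝ)) : Prop where
  finite : 𝒢.Finite
  subset : ∀ g ∈ 𝒢, g ∈ J
  lead_dvd : ∀ h ∈ J, h ≠ 0 → ∃ g ∈ 𝒢, g ≠ 0 ∧ ord.degree g ≤ ord.degree h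
  lead_one : ∀ g ∈ 𝒢, ord.leadingCoeff g = 1
  reduced : ∀ g ∈ 𝒢, ∀ g' ∈ 𝒢, g' ≠ g → ∀ s ∈ g.support, ¬ ord.degree g' ≤ s

/-- A univariate polynomial, evaluated at the variable `λ`. -/
def inLam {n m : ℕ} (u : Polynomial ℝ) : Poly n m := Polynomial.aeval pl u

/-- The set `{u₀, x₁² - u₁, x₂ - u₂ x₁, …, xₙ - uₙ x₁, w₁ - v₁ x₁, …, wₘ - vₘ x₁}`,
where `u₀ ∈ ℝ[λ]` is `u0`, `uᵢ ∈ ℝ[λ]` is `u` at the `i`-th index and `x₁` has index `0`. -/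
def shapeBasis {n m : ℕ} [NeZero n] (u0 : Polynomial ℝ) (u : Fin n → Polynomial ℝ)
    (v : Fin m → Polynomial ℝ) : Set (Poly n m) :=
  {inLam u0, px 0 ^ 2 - inLam (u 0)} ∪
  {g | ∃ i : Fin n, i ≠ 0 ∧ g = px i - inLam (u i) * px 0} ∪
  {g | ∃ j : Fin m, g = pw j - inLam (v j) * px 0}

/-- The ideal is zero-dimensional (finite complex variety), radical, and has a reduced
lexicographic Gröbner basis of the form `shapeBasis`. -/
structure IsRegularIdeal {n m : ℕ} [NeZero n] (J : Ideal (Poly n m)) : Prop where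
  zeroDim : (zeroLocus ℂ J).Finite
  radical : J.IsRadical
  groebner : ∃ (u0 : Polynomial ℝ) (u : Fin n → Polynomial ℝ) (v : Fin m → Polynomial ℝ),
    IsReducedGroebnerBasis (lexOrder n m) (shapeBasis u0 u v) J

section Certificates

variable {n m : ℕ}

/-- Weights for the degree in `(x, w)`. -/
def xwWeight : Var n m → ℕ
  | Var.x _ => 1
  | Var.w _ => 1
  | Var.lam => 0

/-- `f` is homogeneous of degree `l` in `(x, w)` (with coefficients polynomial in `λ`). -/
def HomogXW (f : Poly n m) (l : ℕ) : Prop := IsWeightedHomogeneous xwWeight f l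

/-- `𝓑_N⁻ = {λᵏ xᵢ, λᵏ wⱼ : k ≤ N}`. -/
def basisMinus (n m N : ℕ) : Set (Poly n m) :=
  {b | ∃ k ≤ N, (∃ i, b = pl ^ k * px i) ∨ ∃ j, b = pl ^ k * pw j}

/-- `𝓑_N = {λᵏ, λᵏ xᵢ, λᵏ wⱼ : k ≤ N}`. -/
def basisFull (n m N : ℕ) : Set (Poly n m) :=
  {b | ∃ k ≤ N, b = pl ^ k} ∪ basisMinus n m N

/-- `s` is a finite sum of squares of polynomials supported on the set of monomials `𝓑`. -/
def IsSOSOn (𝓑 : Set (Poly n m)) (s : Poly n m) : Prop :=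
  ∃ (r : ℕ) (v : Fin r → Poly n m), (∀ l, v l ∈ Submodule.span ℝ 𝓑) ∧ s = ∑ l, v l ^ 2

variable (A : Matrix (Fin n) (Fin n) ℝ) (B : Matrix (Fin n) (Fin m) ℝ)
  (C : Matrix (Fin m) (Fin n) ℝ) (D : Matrix (Fin m) (Fin m) ℝ)

/-- `h` has a representation
`h = σ₀ + λ σ_λ + ∑ g σ_g + p · (A x + B w - λ x) + q · (w ⊙ (C x + D w - w)) + r (‖(x, w)‖² - 1)`
with sums of squares of polynomials supported on `𝓑_N` and multipliers of total degree at most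
`2d - 1` (for `p`) and `2d - 2` (for `q`, `r`). Used for `d ≥ 1` only. -/
def HasSphereCertificate (h : Poly n m) (d N : ℕ) : Prop :=
  ∃ (s₀ sl : Poly n m) (s : Poly n m → Poly n m) (p : Fin n → Poly n m) (q : Fin m → Poly n m)
    (r : Poly n m),
    IsSOSOn (basisFull n m N) s₀ ∧ IsSOSOn (basisFull n m N) sl ∧
    (∀ g ∈ ineqs C D, IsSOSOn (basisFull n m N) (s g)) ∧
    (∀ i, (p i).totalDegree ≤ 2 * d - 1) ∧ (∀ j, (q j).totalDegree ≤ 2 * d - 2) ∧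
    r.totalDegree ≤ 2 * d - 2 ∧
    h = s₀ + pl * sl + ∑ g ∈ ineqs C D, g * s g
      + ∑ i, p i * linEq A B i + ∑ j, q j * reluEq C D j + r * (normSq - 1)

/-- The sparse certificate, without the unit sphere constraint, for the bound `ρ` on `f`:
`‖(x, w)‖^{2d-2} (f - ρ ‖(x, w)‖²) = ‖(x, w)‖^{2d-2} (σ₀ + λ σ_λ) + ‖(x, w)‖^{2d-4} ∑ g σ_g
  + p · (A x + B w - λ x) + q · (w ⊙ (C x + D w - w))`
with sums of squares of polynomials supported on `𝓑_N⁻` and multipliers homogeneous in `(x, w)` of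
degree `2d - 1` (for `p`) and `2d - 2` (for `q`). Used for `d ≥ 2` only, where all the powers of the
norm are polynomials. -/
def HasSparseCertificate (f : Poly n m) (ρ : ℝ) (d N : ℕ) : Prop :=
  ∃ (s₀ sl : Poly n m) (s : Poly n m → Poly n m) (p : Fin n → Poly n m) (q : Fin m → Poly n m),
    IsSOSOn (basisMinus n m N) s₀ ∧ IsSOSOn (basisMinus n m N) sl ∧
    (∀ g ∈ ineqs C D, IsSOSOn (basisMinus n m N) (s g)) ∧
    (∀ i, HomogXW (p i) (2 * d - 1)) ∧ (∀ j, HomogXW (q j) (2 * d - 2)) ∧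
    normSq ^ (d - 1) * (f - MvPolynomial.C ρ * normSq) =
      normSq ^ (d - 1) * (s₀ + pl * sl) + normSq ^ (d - 2) * ∑ g ∈ ineqs C D, g * s g
      + ∑ i, p i * linEq A B i + ∑ j, q j * reluEq C D j

end Certificates

end ReLUSparse

end

/-!
The theorem has two independent halves.

*From the sphere to the sparse certificate.* All constraints except the sphere constraint are
homogeneous in `(x, w)`: degree `1` for `A x + B w - λ x`, degree `2` for the ReLU equations and for
the inequalities. The linear map `homogenize d` multiplies the component of degree `2k` in `(x, w)`
by `‖(x, w)‖^{2(d - k)}` and discards the components of odd degree. It is applied to a certificate on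
the sphere: the multiples of `‖(x, w)‖² - 1` vanish (`homogenize_mul_sphere`), the multipliers of
the other equations become homogeneous of the right degree, and for a polynomial `u = a + v` with
`a ∈ ℝ[λ]` and `v` linear in `(x, w)` the mixed term `2 a v` of `u²` disappears, which leaves
`‖(x, w)‖² a² + v²`, a sum of squares supported on `𝓑_N⁻` (`IsSOSOn.exists_components`). The
regularity of the ideal plays no role here.

*Existence.* The complex variety of `I` is finite, so the values at its points of a real polynomial
can be prescribed arbitrarily, as long as conjugate points get conjugate values
(`exists_real_interpolant`); by the shape of the Gröbner basis the interpolant may be taken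
congruent to `a(λ) + b(λ) x₁`, hence supported on some `𝓑_N` (`IsRegularIdeal.exists_interpolant`).
It remains to write every value of `F = f - fmin ‖(x, w)‖²` as a combination of squares with weights
`1`, `λ` and `g ∈ G`. At a nonreal point this is always possible, as `-1` is a square; at a real
point, either `F ≥ 0` or one of the weights is negative (`exists_weights`). The difference of both
sides vanishes on the complex variety and lies in `I` by the Nullstellensatz, as `I` is radical.
-/

namespace ReLUSparse

/-! ### Homogenization with respect to `(x, w)` -/

section Homogenize

variable {n m : ℕ}

/-- Homogenization to degree `2d` in `(x, w)`, with `‖(x, w)‖²` as homogenizing form: the component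
of degree `2k ≤ 2d` is multiplied by `‖(x, w)‖^{2(d - k)}`, and the components of odd degree or of
degree greater than `2d` are discarded. -/
noncomputable def homogenize (d : ℕ) : Poly n m →ₗ[ℝ] Poly n m :=
  ∑ k ∈ Finset.range (d + 1),
    LinearMap.mulLeft ℝ (normSq ^ (d - k)) ∘ₗ weightedHomogeneousComponent xwWeight (2 * k)

theorem homogenize_apply (d : ℕ) (h : Poly n m) :
    homogenize d h = ∑ k ∈ Finset.range (d + 1),
      normSq ^ (d - k) * weightedHomogeneousComponent xwWeight (2 * k) h := by
  simp [homogenize, LinearMap.sum_apply]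

theorem homogenize_of_even {d k : ℕ} (hk : k ≤ d) {h : Poly n m} (hh : HomogXW h (2 * k)) :
    homogenize d h = normSq ^ (d - k) * h := by
  rw [homogenize_apply, Finset.sum_eq_single k]
  · rw [hh.weightedHomogeneousComponent_same]
  · intro j _ hj
    rw [hh.weightedHomogeneousComponent_ne (2 * j) (by omega), mul_zero]
  · intro hk'
    exact absurd (Finset.mem_range.2 (by omega)) hk'

theorem homogenize_of_odd (d k : ℕ) {h : Poly n m} (hh : HomogXW h (2 * k + 1)) :
    homogenize d h = 0 := by
  rw [homogenize_apply]
  refine Finset.sum_eq_zero fun j _ => ?_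
  rw [hh.weightedHomogeneousComponent_ne (2 * j) (by omega), mul_zero]

theorem homogXW_px (i : Fin n) : HomogXW (px i : Poly n m) 1 := isWeightedHomogeneous_X ℝ _ _

theorem homogXW_pw (j : Fin m) : HomogXW (pw j : Poly n m) 1 := isWeightedHomogeneous_X ℝ _ _

theorem homogXW_pl : HomogXW (pl : Poly n m) 0 := isWeightedHomogeneous_X ℝ _ _

theorem homogXW_pl_pow (k : ℕ) : HomogXW ((pl : Poly n m) ^ k) 0 := by
  have := IsWeightedHomogeneous.pow (homogXW_pl (n := n) (m := m)) k
  rwa [smul_zero] at this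

theorem HomogXW.mul_of_add_eq {f g : Poly n m} {a b c : ℕ} (hf : HomogXW f a) (hg : HomogXW g b)
    (h : a + b = c) : HomogXW (f * g) c := by
  subst h
  exact IsWeightedHomogeneous.mul hf hg

theorem homogXW_normSq : HomogXW (normSq : Poly n m) 2 :=
  (IsWeightedHomogeneous.sum _ _ _ fun i _ => (homogXW_px i).pow 2).add
    (IsWeightedHomogeneous.sum _ _ _ fun j _ => (homogXW_pw j).pow 2)

theorem homogXW_normSq_pow (k : ℕ) : HomogXW ((normSq : Poly n m) ^ k) (2 * k) := by
  have := IsWeightedHomogeneous.pow (homogXW_normSq (n := n) (m := m)) k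
  rwa [smul_eq_mul, mul_comm] at this

theorem homogXW_linEq (A : Matrix (Fin n) (Fin n) ℝ) (B : Matrix (Fin n) (Fin m) ℝ) (i : Fin n) :
    HomogXW (linEq A B i) 1 :=
  IsWeightedHomogeneous.sub
    ((IsWeightedHomogeneous.sum _ _ _ fun k _ => (homogXW_px k).C_mul _).add
      (IsWeightedHomogeneous.sum _ _ _ fun j _ => (homogXW_pw j).C_mul _))
    (homogXW_pl.mul_of_add_eq (homogXW_px i) rfl)

theorem homogXW_relIn (C : Matrix (Fin m) (Fin n) ℝ) (D : Matrix (Fin m) (Fin m) ℝ) (j : Fin m) :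
    HomogXW (relIn C D j) 1 :=
  (IsWeightedHomogeneous.sum _ _ _ fun k _ => (homogXW_px k).C_mul _).add
    (IsWeightedHomogeneous.sum _ _ _ fun l _ => (homogXW_pw l).C_mul _)

theorem homogXW_reluEq (C : Matrix (Fin m) (Fin n) ℝ) (D : Matrix (Fin m) (Fin m) ℝ) (j : Fin m) :
    HomogXW (reluEq C D j) 2 :=
  (homogXW_pw j).mul_of_add_eq (IsWeightedHomogeneous.sub (homogXW_relIn C D j) (homogXW_pw j)) rfl

theorem homogXW_ineqs {C : Matrix (Fin m) (Fin n) ℝ} {D : Matrix (Fin m) (Fin m) ℝ}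
    {g : Poly n m} (hg : g ∈ ineqs C D) : HomogXW g 2 := by
  have hsub (j : Fin m) : HomogXW (pw j - relIn C D j) 1 :=
    IsWeightedHomogeneous.sub (homogXW_pw j) (homogXW_relIn C D j)
  simp only [ineqs, Finset.mem_union, Finset.mem_image, Finset.mem_univ, true_and] at hg
  rcases hg with (⟨t, rfl⟩ | ⟨t, rfl⟩) | ⟨t, rfl⟩
  · exact (homogXW_pw _).mul_of_add_eq (homogXW_pw _) rfl
  · exact (homogXW_pw _).mul_of_add_eq (hsub _) rfl
  · exact (hsub _).mul_of_add_eq (hsub _) rfl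

/-- The degree in `(x, w)` is at most the total degree, so only the components of degree `< 2d`
contribute; they are grouped by parity. -/
theorem eq_sum_components {d : ℕ} {p : Poly n m} (hp : p.totalDegree < 2 * d) :
    p = ∑ k ∈ Finset.range d, (weightedHomogeneousComponent xwWeight (2 * k) p +
      weightedHomogeneousComponent xwWeight (2 * k + 1) p) := by
  have hpair : ∀ e : ℕ, ∑ k ∈ Finset.range e, (weightedHomogeneousComponent xwWeight (2 * k) p +
      weightedHomogeneousComponent xwWeight (2 * k + 1) p) =
      ∑ k ∈ Finset.range (2 * e), weightedHomogeneousComponent xwWeight k p := by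
    intro e
    induction e with
    | zero => simp
    | succ e ih =>
      rw [Finset.sum_range_succ, ih, mul_add, mul_one, Finset.sum_range_succ,
        Finset.sum_range_succ, add_assoc]
  rw [hpair]
  ext s
  rw [coeff_sum]
  simp only [coeff_weightedHomogeneousComponent]
  rw [Finset.sum_ite_eq]
  split_ifs with hs
  · rfl
  · by_contra hne
    have h1 : (s.sum fun _ e => e) ≤ p.totalDegree := le_totalDegree (mem_support_iff.2 hne)
    have h2 : Finsupp.weight xwWeight s ≤ s.sum fun _ e => e := by
      rw [Finsupp.weight_apply]
      refine Finset.sum_le_sum fun i _ => ?_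
      cases i <;> simp [xwWeight]
    exact hs (Finset.mem_range.2 (by omega))

theorem exists_homogenize_mul_linear {d : ℕ} {p g : Poly n m} (hp : p.totalDegree < 2 * d)
    (hg : HomogXW g 1) :
    ∃ p' : Poly n m, HomogXW p' (2 * d - 1) ∧ homogenize d (p * g) = p' * g := by
  refine ⟨∑ k ∈ Finset.range d,
    normSq ^ (d - 1 - k) * weightedHomogeneousComponent xwWeight (2 * k + 1) p, ?_, ?_⟩
  · refine IsWeightedHomogeneous.sum _ _ _ fun k hk => ?_
    have := Finset.mem_range.1 hk
    exact (homogXW_normSq_pow _).mul_of_add_eq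
      (weightedHomogeneousComponent_isWeightedHomogeneous _ _) (by omega)
  · conv_lhs => rw [eq_sum_components hp]
    rw [Finset.sum_mul, Finset.sum_mul, map_sum]
    refine Finset.sum_congr rfl fun k hk => ?_
    have hk := Finset.mem_range.1 hk
    have h0 : HomogXW (weightedHomogeneousComponent xwWeight (2 * k) p * g) (2 * k + 1) :=
      (weightedHomogeneousComponent_isWeightedHomogeneous _ _).mul hg
    have h1 : HomogXW (weightedHomogeneousComponent xwWeight (2 * k + 1) p * g) (2 * (k + 1)) :=
      HomogXW.mul_of_add_eq (weightedHomogeneousComponent_isWeightedHomogeneous _ _) hg (by omega)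
    rw [add_mul, map_add, homogenize_of_odd d k h0, homogenize_of_even (by omega) h1, zero_add,
      Nat.sub_sub, add_comm 1 k, mul_assoc]

theorem exists_homogenize_mul_quadratic {d : ℕ} {q g : Poly n m} (hq : q.totalDegree < 2 * d)
    (hg : HomogXW g 2) :
    ∃ q' : Poly n m, HomogXW q' (2 * d - 2) ∧ homogenize d (q * g) = q' * g := by
  refine ⟨∑ k ∈ Finset.range d,
    normSq ^ (d - 1 - k) * weightedHomogeneousComponent xwWeight (2 * k) q, ?_, ?_⟩
  · refine IsWeightedHomogeneous.sum _ _ _ fun k hk => ?_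
    have := Finset.mem_range.1 hk
    exact (homogXW_normSq_pow _).mul_of_add_eq
      (weightedHomogeneousComponent_isWeightedHomogeneous _ _) (by omega)
  · conv_lhs => rw [eq_sum_components hq]
    rw [Finset.sum_mul, Finset.sum_mul, map_sum]
    refine Finset.sum_congr rfl fun k hk => ?_
    have hk := Finset.mem_range.1 hk
    have h0 : HomogXW (weightedHomogeneousComponent xwWeight (2 * k) q * g) (2 * (k + 1)) :=
      HomogXW.mul_of_add_eq (weightedHomogeneousComponent_isWeightedHomogeneous _ _) hg (by omega)
    have h1 : HomogXW (weightedHomogeneousComponent xwWeight (2 * k + 1) q * g)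
        (2 * (k + 1) + 1) :=
      HomogXW.mul_of_add_eq (weightedHomogeneousComponent_isWeightedHomogeneous _ _) hg (by omega)
    rw [add_mul, map_add, homogenize_of_odd d _ h1, homogenize_of_even (by omega) h0, add_zero,
      Nat.sub_sub, add_comm 1 k, mul_assoc]

/-- Homogenization kills the multiples of the sphere constraint, because it sends both `r` and
`r ‖(x, w)‖²` to the same form. -/
theorem homogenize_mul_sphere {d : ℕ} {r : Poly n m} (hr : r.totalDegree < 2 * d) :
    homogenize d (r * (normSq - 1)) = 0 := by
  conv_lhs => rw [eq_sum_components hr]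
  rw [Finset.sum_mul, map_sum]
  refine Finset.sum_eq_zero fun k hk => ?_
  have hk := Finset.mem_range.1 hk
  have h0 : HomogXW (weightedHomogeneousComponent xwWeight (2 * k) r) (2 * k) :=
    weightedHomogeneousComponent_isWeightedHomogeneous _ _
  have h1 : HomogXW (weightedHomogeneousComponent xwWeight (2 * k + 1) r) (2 * k + 1) :=
    weightedHomogeneousComponent_isWeightedHomogeneous _ _
  rw [mul_sub, mul_one, add_mul, map_sub, map_add, map_add,
    homogenize_of_odd d k h1, homogenize_of_even (by omega) h0,
    homogenize_of_odd d (k + 1) (h1.mul_of_add_eq homogXW_normSq (by omega)),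
    homogenize_of_even (k := k + 1) (by omega) (h0.mul_of_add_eq homogXW_normSq (by omega)),
    show d - k = d - (k + 1) + 1 by omega, pow_succ]
  ring

end Homogenize

/-! ### Sums of squares -/

section SOS

variable {n m : ℕ} {𝓑 : Set (Poly n m)}

theorem IsSOSOn.zero : IsSOSOn 𝓑 0 := ⟨0, Fin.elim0, fun l => l.elim0, by simp⟩

theorem IsSOSOn.sq {v : Poly n m} (hv : v ∈ Submodule.span ℝ 𝓑) : IsSOSOn 𝓑 (v ^ 2) :=
  ⟨1, fun _ => v, fun _ => hv, by simp⟩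

theorem IsSOSOn.add {s t : Poly n m} (hs : IsSOSOn 𝓑 s) (ht : IsSOSOn 𝓑 t) :
    IsSOSOn 𝓑 (s + t) := by
  obtain ⟨a, u, hu, rfl⟩ := hs
  obtain ⟨b, v, hv, rfl⟩ := ht
  refine ⟨a + b, Fin.append u v, fun l => ?_, by simp [Fin.sum_univ_add]⟩
  refine Fin.addCases (fun i => ?_) (fun i => ?_) l
  · simpa using hu i
  · simpa using hv i

theorem IsSOSOn.sum {ι : Type*} (I : Finset ι) {s : ι → Poly n m}
    (hs : ∀ i ∈ I, IsSOSOn 𝓑 (s i)) : IsSOSOn 𝓑 (∑ i ∈ I, s i) :=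
  Finset.sum_induction _ _ (fun _ _ => IsSOSOn.add) IsSOSOn.zero hs

theorem basisFull_mono {N N' : ℕ} (h : N ≤ N') : basisFull n m N ⊆ basisFull n m N' := by
  rintro b (⟨k, hk, hb⟩ | ⟨k, hk, hb⟩)
  · exact Or.inl ⟨k, hk.trans h, hb⟩
  · exact Or.inr ⟨k, hk.trans h, hb⟩

theorem homogXW_of_mem_span_basisMinus {N : ℕ} {v : Poly n m}
    (hv : v ∈ Submodule.span ℝ (basisMinus n m N)) : HomogXW v 1 := by
  have hle : Submodule.span ℝ (basisMinus n m N) ≤ weightedHomogeneousSubmodule ℝ xwWeight 1 := by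
    refine Submodule.span_le.2 ?_
    rintro b ⟨k, -, ⟨i, rfl⟩ | ⟨j, rfl⟩⟩
    · exact (homogXW_pl_pow k).mul_of_add_eq (homogXW_px i) rfl
    · exact (homogXW_pl_pow k).mul_of_add_eq (homogXW_pw j) rfl
  exact hle hv

/-- A polynomial supported on `𝓑_N` is the sum of a polynomial `a` in `λ` and of one that is
supported on `𝓑_N⁻`; all the products `a xᵢ` and `a wⱼ` are supported on `𝓑_N⁻` too. -/
theorem exists_split_of_mem_span_basisFull {N : ℕ} {u : Poly n m}
    (hu : u ∈ Submodule.span ℝ (basisFull n m N)) :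
    ∃ a v : Poly n m, u = a + v ∧ HomogXW a 0 ∧ v ∈ Submodule.span ℝ (basisMinus n m N) ∧
      (∀ i, a * px i ∈ Submodule.span ℝ (basisMinus n m N)) ∧
      ∀ j, a * pw j ∈ Submodule.span ℝ (basisMinus n m N) := by
  rw [basisFull, Submodule.span_union, Submodule.mem_sup] at hu
  obtain ⟨a, ha, v, hv, rfl⟩ := hu
  refine ⟨a, v, rfl, ?_, hv, fun i => ?_, fun j => ?_⟩
  · have hle : Submodule.span ℝ {b : Poly n m | ∃ k ≤ N, b = pl ^ k} ≤
        weightedHomogeneousSubmodule ℝ xwWeight 0 := by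
      refine Submodule.span_le.2 ?_
      rintro b ⟨k, -, rfl⟩
      exact homogXW_pl_pow k
    exact hle ha
  · have hle : Submodule.span ℝ {b : Poly n m | ∃ k ≤ N, b = pl ^ k} ≤
        (Submodule.span ℝ (basisMinus n m N)).comap (LinearMap.mulRight ℝ (px i)) := by
      refine Submodule.span_le.2 ?_
      rintro b ⟨k, hk, rfl⟩
      exact Submodule.subset_span ⟨k, hk, Or.inl ⟨i, rfl⟩⟩
    exact hle ha
  · have hle : Submodule.span ℝ {b : Poly n m | ∃ k ≤ N, b = pl ^ k} ≤
        (Submodule.span ℝ (basisMinus n m N)).comap (LinearMap.mulRight ℝ (pw j)) := by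
      refine Submodule.span_le.2 ?_
      rintro b ⟨k, hk, rfl⟩
      exact Submodule.subset_span ⟨k, hk, Or.inr ⟨j, rfl⟩⟩
    exact hle ha

/-- For `u = a + v` the components of `u²` are `a²`, `2 a v` and `v²`. Homogenizing the even part
gives `‖(x, w)‖² a² + v² = ∑ (a xᵢ)² + ∑ (a wⱼ)² + v²`, a sum of squares supported on `𝓑_N⁻`. -/
theorem IsSOSOn.exists_components {N : ℕ} {s : Poly n m} (hs : IsSOSOn (basisFull n m N) s) :
    ∃ s₀ s₁ s₂ : Poly n m, s = s₀ + s₁ + s₂ ∧ HomogXW s₀ 0 ∧ HomogXW s₁ 1 ∧ HomogXW s₂ 2 ∧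
      IsSOSOn (basisMinus n m N) (normSq * s₀ + s₂) := by
  obtain ⟨r, u, hu, rfl⟩ := hs
  choose a v huv ha hv hax haw using fun l => exists_split_of_mem_span_basisFull (hu l)
  have hv1 := fun l => homogXW_of_mem_span_basisMinus (hv l)
  refine ⟨∑ l, a l ^ 2, ∑ l, 2 * (a l * v l), ∑ l, v l ^ 2, ?_, ?_, ?_, ?_, ?_⟩
  · rw [← Finset.sum_add_distrib, ← Finset.sum_add_distrib]
    exact Finset.sum_congr rfl fun l _ => by rw [huv l]; ring
  · exact IsWeightedHomogeneous.sum _ _ _ fun l _ => (ha l).pow 2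
  · refine IsWeightedHomogeneous.sum _ _ _ fun l _ => ?_
    exact ((ha l).mul_of_add_eq (hv1 l) rfl).C_mul 2
  · exact IsWeightedHomogeneous.sum _ _ _ fun l _ => (hv1 l).pow 2
  · rw [Finset.mul_sum, ← Finset.sum_add_distrib]
    refine IsSOSOn.sum _ fun l _ => IsSOSOn.add ?_ (IsSOSOn.sq (hv l))
    have h : normSq * a l ^ 2 = ∑ i, (a l * px i) ^ 2 + ∑ j, (a l * pw j) ^ 2 := by
      simp only [normSq, add_mul, Finset.sum_mul, mul_pow, mul_comm (a l ^ 2)]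
    rw [h]
    exact (IsSOSOn.sum _ fun i _ => IsSOSOn.sq (hax l i)).add
      (IsSOSOn.sum _ fun j _ => IsSOSOn.sq (haw l j))

theorem IsSOSOn.exists_homogenize {N : ℕ} {s : Poly n m} (hs : IsSOSOn (basisFull n m N) s) :
    ∃ t, IsSOSOn (basisMinus n m N) t ∧
      (∀ d, 1 ≤ d → ∀ g, HomogXW g 0 → homogenize d (g * s) = normSq ^ (d - 1) * (g * t)) ∧
      ∀ d, 2 ≤ d → ∀ g, HomogXW g 2 → homogenize d (g * s) = normSq ^ (d - 2) * (g * t) := by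
  obtain ⟨s₀, s₁, s₂, rfl, h₀, h₁, h₂, ht⟩ := hs.exists_components
  refine ⟨_, ht, fun d hd g hg => ?_, fun d hd g hg => ?_⟩
  · obtain ⟨e, rfl⟩ := Nat.exists_eq_add_of_le' hd
    rw [mul_add, mul_add, map_add, map_add,
      homogenize_of_even (k := 0) (by omega) (hg.mul_of_add_eq h₀ rfl),
      homogenize_of_odd _ 0 (hg.mul_of_add_eq h₁ rfl),
      homogenize_of_even (k := 1) (by omega) (hg.mul_of_add_eq h₂ rfl)]
    simp only [Nat.add_sub_cancel, Nat.sub_zero, pow_succ]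
    ring
  · obtain ⟨e, rfl⟩ := Nat.exists_eq_add_of_le' hd
    rw [mul_add, mul_add, map_add, map_add,
      homogenize_of_even (k := 1) (by omega) (hg.mul_of_add_eq h₀ rfl),
      homogenize_of_odd _ 1 (hg.mul_of_add_eq h₁ rfl),
      homogenize_of_even (k := 2) (by omega) (hg.mul_of_add_eq h₂ rfl)]
    simp only [Nat.add_sub_cancel, show e + 2 - 1 = e + 1 from rfl, pow_succ]
    ring

/-- Homogenizing a certificate on the sphere removes the sphere constraint. -/
theorem HasSphereCertificate.hasSparseCertificate {A : Matrix (Fin n) (Fin n) ℝ}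
    {B : Matrix (Fin n) (Fin m) ℝ} {C : Matrix (Fin m) (Fin n) ℝ} {D : Matrix (Fin m) (Fin m) ℝ}
    {f : Poly n m} (hf : HomogXW f 2) {ρ : ℝ} {d N : ℕ} (hd : 2 ≤ d)
    (h : HasSphereCertificate A B C D (f - MvPolynomial.C ρ * normSq) d N) :
    HasSparseCertificate A B C D f ρ d N := by
  obtain ⟨s₀, sl, s, p, q, r, hs₀, hsl, hs, hp, hq, hr, heq⟩ := h
  obtain ⟨t₀, ht₀, ht₀', -⟩ := hs₀.exists_homogenize
  obtain ⟨tl, htl, htl', -⟩ := hsl.exists_homogenize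
  have ht : ∀ g, ∃ t, g ∈ ineqs C D → IsSOSOn (basisMinus n m N) t ∧
      homogenize d (g * s g) = normSq ^ (d - 2) * (g * t) := by
    intro g
    by_cases hg : g ∈ ineqs C D
    · obtain ⟨t, ht, -, ht'⟩ := (hs g hg).exists_homogenize
      exact ⟨t, fun _ => ⟨ht, ht' d hd g (homogXW_ineqs hg)⟩⟩
    · exact ⟨0, fun h => absurd h hg⟩
  choose t ht using ht
  choose p' hp' hpe using fun i =>
    exists_homogenize_mul_linear (d := d) (p := p i) (by have := hp i; omega) (homogXW_linEq A B i)
  choose q' hq' hqe using fun j =>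
    exists_homogenize_mul_quadratic (d := d) (q := q j) (by have := hq j; omega)
      (homogXW_reluEq C D j)
  refine ⟨t₀, tl, t, p', q', ht₀, htl, fun g hg => (ht g hg).1, hp', hq', ?_⟩
  have hfh : HomogXW (f - MvPolynomial.C ρ * normSq) (2 * 1) :=
    IsWeightedHomogeneous.sub hf (homogXW_normSq.C_mul ρ)
  have h0 : homogenize d s₀ = normSq ^ (d - 1) * t₀ := by
    simpa using ht₀' d (by omega) 1 (isWeightedHomogeneous_one ℝ _)
  rw [← homogenize_of_even (by omega) hfh, heq]
  simp only [map_add, map_sum]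
  rw [h0, htl' d (by omega) pl homogXW_pl, homogenize_mul_sphere (by omega),
    Finset.sum_congr rfl fun g hg => (ht g hg).2, Finset.sum_congr rfl fun i _ => hpe i,
    Finset.sum_congr rfl fun j _ => hqe j, ← Finset.mul_sum]
  ring

end SOS

/-! ### Real interpolation at finitely many complex points -/

section Interpolation

variable {σ : Type*}

open ComplexConjugate

/-- The complex conjugate of a point. -/
def conjPt (z : σ → ℂ) : σ → ℂ := fun i => conj (z i)

theorem conjPt_conjPt (z : σ → ℂ) : conjPt (conjPt z) = z := by
  funext i
  exact Complex.conj_conj _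

theorem aeval_conjPt (z : σ → ℂ) (p : MvPolynomial σ ℝ) :
    aeval (conjPt z) p = conj (aeval z p) := by
  induction p using MvPolynomial.induction_on with
  | C a => simp
  | add p q hp hq => simp [hp, hq]
  | mul_X p i hp => simp [hp, conjPt]

theorem aeval_ofReal (x : σ → ℝ) (p : MvPolynomial σ ℝ) :
    aeval (fun i => (x i : ℂ)) p = (eval x p : ℂ) := by
  induction p using MvPolynomial.induction_on with
  | C a => simp
  | add p q hp hq => simp [hp, hq]
  | mul_X p i hp => simp [hp]

theorem exists_ofReal_of_conjPt_eq {z : σ → ℂ} (hz : conjPt z = z) :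
    ∃ x : σ → ℝ, z = fun i => (x i : ℂ) :=
  ⟨fun i => (z i).re, funext fun i => (Complex.conj_eq_iff_re.1 (congrFun hz i)).symm⟩

theorem conjPt_mem_zeroLocus {J : Ideal (MvPolynomial σ ℝ)} {z : σ → ℂ}
    (hz : z ∈ zeroLocus ℂ J) : conjPt z ∈ zeroLocus ℂ J := fun p hp => by
  rw [aeval_conjPt, hz p hp, map_zero]

theorem exists_interpolant {K : Type*} [Field K] (V : Finset (σ → K)) (φ : (σ → K) → K) :
    ∃ P : MvPolynomial σ K, ∀ z ∈ V, eval z P = φ z := by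
  classical
  -- Factors of the Lagrange basis: a coordinate separates any two distinct points.
  have hsep : ∀ z y : σ → K, ∃ P : MvPolynomial σ K, y ≠ z → eval z P = 1 ∧ eval y P = 0 := by
    intro z y
    by_cases h : y = z
    · exact ⟨0, fun h' => absurd h h'⟩
    · obtain ⟨i, hi⟩ := Function.ne_iff.1 h
      refine ⟨C (z i - y i)⁻¹ * (X i - C (y i)), fun _ => ⟨?_, by simp⟩⟩
      simpa using inv_mul_cancel₀ (sub_ne_zero.2 hi.symm)
  choose P hP using hsep
  refine ⟨∑ z ∈ V, C (φ z) * ∏ y ∈ V.erase z, P z y, fun z hz => ?_⟩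
  rw [map_sum, Finset.sum_eq_single z]
  · rw [map_mul, map_prod, eval_C, Finset.prod_eq_one, mul_one]
    exact fun y hy => (hP z y (Finset.ne_of_mem_erase hy)).1
  · intro y _ hyz
    rw [map_mul, map_prod, Finset.prod_eq_zero (Finset.mem_erase.2 ⟨hyz.symm, hz⟩), mul_zero]
    exact (hP y z hyz.symm).2
  · exact fun h => absurd hz h

theorem exists_real_imaginary_parts (P : MvPolynomial σ ℂ) :
    ∃ p q : MvPolynomial σ ℝ, ∀ z : σ → ℂ, eval z P = aeval z p + Complex.I * aeval z q := by
  induction P using MvPolynomial.induction_on with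
  | C a =>
    refine ⟨C a.re, C a.im, fun z => ?_⟩
    simpa [mul_comm] using (Complex.re_add_im a).symm
  | add P Q hP hQ =>
    obtain ⟨p, q, h⟩ := hP
    obtain ⟨p', q', h'⟩ := hQ
    refine ⟨p + p', q + q', fun z => ?_⟩
    rw [map_add, h, h', map_add, map_add]
    ring
  | mul_X P i hP =>
    obtain ⟨p, q, h⟩ := hP
    refine ⟨p * X i, q * X i, fun z => ?_⟩
    rw [map_mul, h, map_mul, map_mul, eval_X, aeval_X]
    ring

/-- The real part of a complex interpolant still interpolates values that are compatible with
complex conjugation. -/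
theorem exists_real_interpolant {V : Set (σ → ℂ)} (hV : V.Finite)
    (hconj : ∀ z ∈ V, conjPt z ∈ V) (φ : (σ → ℂ) → ℂ)
    (hφ : ∀ z ∈ V, φ (conjPt z) = conj (φ z)) :
    ∃ h : MvPolynomial σ ℝ, ∀ z ∈ V, aeval z h = φ z := by
  obtain ⟨P, hP⟩ := exists_interpolant hV.toFinset φ
  obtain ⟨p, q, hpq⟩ := exists_real_imaginary_parts P
  refine ⟨p, fun z hz => ?_⟩
  have h1 := hP z (hV.mem_toFinset.2 hz)
  have h2 := hP (conjPt z) (hV.mem_toFinset.2 (hconj z hz))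
  rw [hpq] at h1 h2
  rw [hφ z hz, aeval_conjPt, aeval_conjPt] at h2
  have h3 := congrArg conj h2
  simp only [map_add, map_mul, Complex.conj_conj, Complex.conj_I] at h3
  linear_combination (h1 + h3) / 2

/-- A square root of `-1` at the nonreal points that is compatible with conjugation: the sign of the
imaginary part at a coordinate which depends only on the set of the nonreal coordinates. It vanishes
at the real points. -/
theorem exists_equivariant_imaginary_unit [Nonempty σ] :
    ∃ j : (σ → ℂ) → ℂ, (∀ z, j (conjPt z) = conj (j z)) ∧
      (∀ z, conjPt z = z → j z = 0) ∧ ∀ z, conjPt z ≠ z → j z ^ 2 = -1 := by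
  let c : (σ → ℂ) → σ := fun z => Classical.epsilon fun i => (z i).im ≠ 0
  have hc : ∀ z, c (conjPt z) = c z := fun z => by simp [c, conjPt]
  refine ⟨fun z => Complex.I * (Real.sign (z (c z)).im : ℝ), fun z => ?_, fun z hz => ?_,
    fun z hz => ?_⟩
  · simp only [hc]
    simp [conjPt, Real.sign_neg]
  · have : (z (c z)).im = 0 := Complex.conj_eq_iff_im.1 (congrFun hz (c z))
    simp [this]
  · have h : ∃ i, (z i).im ≠ 0 := by
      by_contra! h
      exact hz (funext fun i => Complex.conj_eq_iff_im.2 (h i))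
    have hi : (z (c z)).im ≠ 0 := Classical.epsilon_spec h
    rcases Real.sign_apply_eq_of_ne_zero _ hi with h' | h' <;> simp [h']

end Interpolation

/-! ### Reduction modulo the ideal -/

section NormalForm

variable {n m : ℕ}

theorem inLam_mem_span (u : Polynomial ℝ) {N : ℕ} (hN : u.natDegree ≤ N) :
    (inLam u : Poly n m) ∈ Submodule.span ℝ (basisFull n m N) := by
  rw [inLam, Polynomial.aeval_eq_sum_range' (Nat.lt_succ_of_le hN)]
  exact Submodule.sum_mem _ fun k hk => Submodule.smul_mem _ _ <| Submodule.subset_span <|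
    Or.inl ⟨k, Nat.lt_succ_iff.1 (Finset.mem_range.1 hk), rfl⟩

theorem inLam_mul_px_mem_span (u : Polynomial ℝ) (i : Fin n) {N : ℕ} (hN : u.natDegree ≤ N) :
    (inLam u * px i : Poly n m) ∈ Submodule.span ℝ (basisFull n m N) := by
  rw [inLam, Polynomial.aeval_eq_sum_range' (Nat.lt_succ_of_le hN), Finset.sum_mul]
  refine Submodule.sum_mem _ fun k hk => ?_
  rw [smul_mul_assoc]
  exact Submodule.smul_mem _ _ <| Submodule.subset_span <|
    Or.inr ⟨k, Nat.lt_succ_iff.1 (Finset.mem_range.1 hk), Or.inl ⟨i, rfl⟩⟩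

/-- The elements of the shape basis rewrite every polynomial as `a(λ) + b(λ) x₁`. -/
theorem exists_normal_form [NeZero n] {J : Ideal (Poly n m)} {u0 : Polynomial ℝ}
    {u : Fin n → Polynomial ℝ} {v : Fin m → Polynomial ℝ}
    (hJ : ∀ g ∈ shapeBasis u0 u v, g ∈ J) (h : Poly n m) :
    ∃ a b : Polynomial ℝ, h - (inLam a + inLam b * px 0) ∈ J := by
  have hx0 : px 0 ^ 2 - inLam (u 0) ∈ J := hJ _ (Or.inl (Or.inl (Or.inr rfl)))
  -- Multiplication by a polynomial that is congruent to `c x₁` preserves the normal forms.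
  have hmul : ∀ (c : Polynomial ℝ) (y p : Poly n m), y - inLam c * px 0 ∈ J →
      (∃ a b : Polynomial ℝ, p - (inLam a + inLam b * px 0) ∈ J) →
      ∃ a b : Polynomial ℝ, p * y - (inLam a + inLam b * px 0) ∈ J := by
    rintro c y p hy ⟨a, b, hp⟩
    refine ⟨b * c * u 0, a * c, ?_⟩
    have := J.add_mem (J.add_mem (J.mul_mem_left y hp)
      (J.mul_mem_left (inLam a + inLam b * px 0) hy))
      (J.mul_mem_left (inLam b * inLam c) hx0)
    convert this using 1
    simp only [inLam, map_mul]
    ring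
  induction h using MvPolynomial.induction_on with
  | C r =>
    refine ⟨Polynomial.C r, 0, ?_⟩
    simp [inLam, MvPolynomial.algebraMap_eq]
  | add p q hp hq =>
    obtain ⟨a, b, h⟩ := hp
    obtain ⟨a', b', h'⟩ := hq
    refine ⟨a + a', b + b', ?_⟩
    convert J.add_mem h h' using 1
    simp only [inLam, map_add]
    ring
  | mul_X p i hp =>
    cases i with
    | x i =>
      by_cases hi : i = 0
      · subst hi
        refine hmul 1 _ p ?_ hp
        simp [inLam, px]
      · exact hmul (u i) _ p (hJ _ (Or.inl (Or.inr ⟨i, hi, rfl⟩))) hp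
    | w j => exact hmul (v j) _ p (hJ _ (Or.inr ⟨j, rfl⟩)) hp
    | lam =>
      obtain ⟨a, b, h⟩ := hp
      refine ⟨a * Polynomial.X, b * Polynomial.X, ?_⟩
      convert J.mul_mem_left pl h using 1
      simp only [inLam, map_mul, Polynomial.aeval_X, pl]
      ring

theorem exists_congruent_mem_span [NeZero n] {J : Ideal (Poly n m)} (hJ : IsRegularIdeal J)
    (h : Poly n m) :
    ∃ N, ∃ h' ∈ Submodule.span ℝ (basisFull n m N), h - h' ∈ J := by
  obtain ⟨u0, u, v, hG⟩ := hJ.groebner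
  obtain ⟨a, b, hab⟩ := exists_normal_form hG.subset h
  exact ⟨max a.natDegree b.natDegree, _, Submodule.add_mem _
    (inLam_mem_span a (le_max_left _ _)) (inLam_mul_px_mem_span b 0 (le_max_right _ _)), hab⟩

/-- A real polynomial interpolant at the points of the variety can be chosen supported on `𝓑_N`. -/
theorem IsRegularIdeal.exists_interpolant [NeZero n] {J : Ideal (Poly n m)}
    (hJ : IsRegularIdeal J) (φ : (Var n m → ℂ) → ℂ)
    (hφ : ∀ z ∈ zeroLocus ℂ J, φ (conjPt z) = starRingEnd ℂ (φ z)) :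
    ∃ N, ∃ h ∈ Submodule.span ℝ (basisFull n m N), ∀ z ∈ zeroLocus ℂ J, aeval z h = φ z := by
  obtain ⟨h, hh⟩ := exists_real_interpolant hJ.zeroDim (fun _ hz => conjPt_mem_zeroLocus hz) φ hφ
  obtain ⟨N, h', hN, hmem⟩ := exists_congruent_mem_span hJ h
  refine ⟨N, h', hN, fun z hz => ?_⟩
  have h0 : aeval z (h - h') = 0 := hz _ hmem
  rw [map_sub, sub_eq_zero] at h0
  rw [← h0, hh z hz]

end NormalForm

/-! ### Existence of a certificate on the sphere -/

section Existence

variable {n m : ℕ} {A : Matrix (Fin n) (Fin n) ℝ} {B : Matrix (Fin n) (Fin m) ℝ}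
  {C : Matrix (Fin m) (Fin n) ℝ} {D : Matrix (Fin m) (Fin m) ℝ}

theorem exists_multipliers_of_mem_eqIdeal {h : Poly n m} (hh : h ∈ eqIdeal A B C D) :
    ∃ (p : Fin n → Poly n m) (q : Fin m → Poly n m) (r : Poly n m),
      h = ∑ i, p i * linEq A B i + ∑ j, q j * reluEq C D j + r * (normSq - 1) := by
  rw [eqIdeal, eqs, Ideal.span_union, Ideal.span_union] at hh
  obtain ⟨b, hb, c, hc, hbc⟩ := Submodule.mem_sup.1 hh
  obtain ⟨s, hs, t, ht, hst⟩ := Submodule.mem_sup.1 hb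
  obtain ⟨p, hp⟩ := (Ideal.mem_span_range_iff_exists_fun (v := linEq A B) (x := s)).1 hs
  obtain ⟨q, hq⟩ := (Ideal.mem_span_range_iff_exists_fun (v := reluEq C D) (x := t)).1 ht
  obtain ⟨r, hr⟩ := Ideal.mem_span_singleton'.1 hc
  exact ⟨p, q, r, by rw [hp, hq, hr, hst, hbc]⟩

/-- At a real point of the variety, the value of `f - fmin ‖(x, w)‖²` is a combination of squares
with weights `1`, `λ` and `g ∈ G`: it is nonnegative on the minimization domain, and outside this
domain one of the other weights is negative. -/
theorem exists_weights {f : Poly n m} {fmin : ℝ}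
    (hmin : IsLeast ((fun z => eval z f) '' feasibleSet A B C D) fmin ∨
      IsLeast ((fun z => eval z f) '' solSet A B C D) fmin)
    {z : Var n m → ℝ} (hz : ∀ e ∈ eqs A B C D, eval z e = 0) :
    ∃ (a c : ℝ) (e : Poly n m → ℝ), eval z (f - MvPolynomial.C fmin * normSq) =
      a ^ 2 + z Var.lam * c ^ 2 + ∑ g ∈ ineqs C D, eval z g * e g ^ 2 := by
  classical
  set F := eval z (f - MvPolynomial.C fmin * normSq) with hF
  by_cases hF0 : 0 ≤ F
  · exact ⟨√F, 0, 0, by simp [Real.sq_sqrt hF0]⟩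
  push Not at hF0
  have hsphere : eval z normSq = 1 := by
    have := hz (normSq - 1) (Or.inr rfl)
    rwa [map_sub, map_one, sub_eq_zero] at this
  have hlt : eval z f < fmin := by
    rw [map_sub, map_mul, eval_C, hsphere] at hF
    linarith
  by_cases hl : z Var.lam < 0
  · refine ⟨0, √(F / z Var.lam), 0, ?_⟩
    rw [Real.sq_sqrt (div_nonneg_of_nonpos hF0.le hl.le), mul_div_cancel₀ _ hl.ne]
    simp
  push Not at hl
  have hg : ∃ g ∈ ineqs C D, eval z g < 0 := by
    by_contra! hg
    have hS : z ∈ solSet A B C D := ⟨hg, hz⟩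
    rcases hmin with hmin | hmin
    · exact absurd (hmin.2 ⟨z, ⟨hS, hl⟩, rfl⟩) (not_le.2 hlt)
    · exact absurd (hmin.2 ⟨z, hS, rfl⟩) (not_le.2 hlt)
  obtain ⟨g, hgm, hg⟩ := hg
  refine ⟨0, 0, fun g' => if g' = g then √(F / eval z g) else 0, ?_⟩
  rw [Finset.sum_eq_single_of_mem g hgm fun g' _ hne => by simp [hne]]
  simp only [if_true]
  rw [Real.sq_sqrt (div_nonneg_of_nonpos hF0.le hg.le), mul_div_cancel₀ _ hg.ne]
  simp

/-- The values of the required sums of squares are prescribed at the points of the variety. At a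
nonreal point the square root `j` of `-1` makes every value `F` a sum of two squares:
`F = ((F + 1) / 2)² + (j (F - 1) / 2)²`. -/
theorem exists_hasSphereCertificate [NeZero n] (hI : IsRegularIdeal (eqIdeal A B C D))
    {f : Poly n m} {fmin : ℝ}
    (hmin : IsLeast ((fun z => eval z f) '' feasibleSet A B C D) fmin ∨
      IsLeast ((fun z => eval z f) '' solSet A B C D) fmin) :
    ∃ d N : ℕ, 2 ≤ d ∧
      HasSphereCertificate A B C D (f - MvPolynomial.C fmin * normSq) d N := by
  classical
  set F : Poly n m := f - MvPolynomial.C fmin * normSq with hF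
  have hreal : ∀ z : Var n m → ℂ, ∃ (a c : ℝ) (e : Poly n m → ℝ),
      z ∈ zeroLocus ℂ (eqIdeal A B C D) → conjPt z = z →
      aeval z F = (a : ℂ) ^ 2 + aeval z (pl : Poly n m) * (c : ℂ) ^ 2 +
        ∑ g ∈ ineqs C D, aeval z g * (e g : ℂ) ^ 2 := by
    intro z
    by_cases h : z ∈ zeroLocus ℂ (eqIdeal A B C D) ∧ conjPt z = z
    · obtain ⟨hz, hr⟩ := h
      obtain ⟨x, rfl⟩ := exists_ofReal_of_conjPt_eq hr
      have hx : ∀ e ∈ eqs A B C D, eval x e = 0 := by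
        intro e he
        have := hz e (Ideal.subset_span he)
        rwa [aeval_ofReal, Complex.ofReal_eq_zero] at this
      obtain ⟨a, c, e, h⟩ := exists_weights hmin hx
      refine ⟨a, c, e, fun _ _ => ?_⟩
      simp only [aeval_ofReal]
      rw [← hF] at h
      rw [h]
      simp [pl]
    · exact ⟨0, 0, 0, fun h1 h2 => absurd ⟨h1, h2⟩ h⟩
  choose a c e hace using hreal
  -- The interpolants `ha` and `hb` take the values `(F + 1) / 2` and `j (F - 1) / 2` at the nonreal
  -- points, where all others vanish; at the real points `hb` vanishes, because `j` does.
  have : Nonempty (Var n m) := ⟨Var.lam⟩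
  obtain ⟨j, hjc, hj0, hj1⟩ := exists_equivariant_imaginary_unit (σ := Var n m)
  have hRc : ∀ z : Var n m → ℂ, conjPt (conjPt z) = conjPt z ↔ conjPt z = z := fun z => by
    rw [conjPt_conjPt, eq_comm]
  -- Real values at the real points and conjugation-compatible values elsewhere can be glued.
  have hite : ∀ (t : (Var n m → ℂ) → ℝ) (s : (Var n m → ℂ) → ℂ),
      (∀ z, s (conjPt z) = starRingEnd ℂ (s z)) →
      ∀ z, (if conjPt (conjPt z) = conjPt z then (t (conjPt z) : ℂ) else s (conjPt z)) =
        starRingEnd ℂ (if conjPt z = z then (t z : ℂ) else s z) := by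
    intro t s hs z
    by_cases hz : conjPt z = z
    · rw [if_pos ((hRc z).2 hz), if_pos hz, hz, Complex.conj_ofReal]
    · rw [if_neg (mt (hRc z).1 hz), if_neg hz, hs]
  obtain ⟨Na, ha, hNa, ha'⟩ := hI.exists_interpolant
    (fun z => if conjPt z = z then (a z : ℂ) else (aeval z F + 1) / 2)
    fun z _ => hite a (fun z => (aeval z F + 1) / 2) (fun z => by
      simp only [aeval_conjPt, map_div₀, map_add, map_one, map_ofNat]) z
  obtain ⟨Nb, hb, hNb, hb'⟩ := hI.exists_interpolant (fun z => j z * ((aeval z F - 1) / 2))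
    fun z _ => by
      simp only [aeval_conjPt, hjc, map_mul, map_div₀, map_sub, map_one, map_ofNat]
  obtain ⟨Nc, hc, hNc, hc'⟩ := hI.exists_interpolant
    (fun z => if conjPt z = z then (c z : ℂ) else 0)
    fun z _ => hite c (fun _ => 0) (fun z => by simp) z
  choose Ne he hNe he' using fun g => hI.exists_interpolant
    (fun z => if conjPt z = z then (e z g : ℂ) else 0)
    fun z _ => hite (fun z => e z g) (fun _ => 0) (fun z => by simp) z
  let N := Na + Nb + Nc + ∑ g ∈ ineqs C D, Ne g
  have hsq : ∀ {M : ℕ} {h : Poly n m}, M ≤ N → h ∈ Submodule.span ℝ (basisFull n m M) →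
      IsSOSOn (basisFull n m N) (h ^ 2) := fun hM hh =>
    IsSOSOn.sq (Submodule.span_mono (basisFull_mono hM) hh)
  have hmem : F - (ha ^ 2 + hb ^ 2 + pl * hc ^ 2 + ∑ g ∈ ineqs C D, g * he g ^ 2) ∈
      eqIdeal A B C D := by
    rw [← hI.radical.radical, ← vanishingIdeal_zeroLocus_eq_radical (K := ℂ)]
    intro z hz
    simp only [map_sub, map_add, map_mul, map_pow, map_sum, ha' z hz, hb' z hz, hc' z hz,
      he' _ z hz]
    by_cases hr : conjPt z = z
    · simp only [if_pos hr, hj0 z hr]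
      rw [hace z hz hr]
      ring
    · simp only [if_neg hr]
      rw [mul_pow, hj1 z hr, Finset.sum_eq_zero fun g _ => by simp]
      ring
  obtain ⟨p, q, r, hpqr⟩ := exists_multipliers_of_mem_eqIdeal hmem
  refine ⟨2 + ∑ i, (p i).totalDegree + ∑ j, (q j).totalDegree + r.totalDegree, N, by omega,
    ha ^ 2 + hb ^ 2, hc ^ 2, fun g => he g ^ 2, p, q, r,
    (hsq (by omega) hNa).add (hsq (by omega) hNb), hsq (by omega) hNc, fun g hg => ?_,
    fun i => ?_, fun j => ?_, by omega, ?_⟩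
  · have := Finset.single_le_sum (fun g _ => Nat.zero_le (Ne g)) hg
    exact hsq (by omega) (hNe g)
  · have := Finset.single_le_sum (fun i _ => Nat.zero_le (p i).totalDegree) (Finset.mem_univ i)
    omega
  · have := Finset.single_le_sum (fun j _ => Nat.zero_le (q j).totalDegree) (Finset.mem_univ j)
    omega
  · linear_combination hpqr

end Existence

end ReLUSparse

theorem mainTheorem3 {n m : ℕ} [NeZero n]
    (A : Matrix (Fin n) (Fin n) ℝ) (B : Matrix (Fin n) (Fin m) ℝ)
    (C : Matrix (Fin m) (Fin n) ℝ) (D : Matrix (Fin m) (Fin m) ℝ)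
    (hI : ReLUSparse.IsRegularIdeal (ReLUSparse.eqIdeal A B C D))
    (f : ReLUSparse.Poly n m) (hf : ReLUSparse.HomogXW f 2) (fmin : ℝ)
    (hmin : IsLeast ((fun z => MvPolynomial.eval z f) '' ReLUSparse.feasibleSet A B C D) fmin ∨
      IsLeast ((fun z => MvPolynomial.eval z f) '' ReLUSparse.solSet A B C D) fmin) :
    (∃ d N : ℕ, 2 ≤ d ∧ ReLUSparse.HasSphereCertificate A B C D
        (f - MvPolynomial.C fmin * ReLUSparse.normSq) d N) ∧
    ∀ d N : ℕ, 2 ≤ d → ReLUSparse.HasSphereCertificate A B C D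
        (f - MvPolynomial.C fmin * ReLUSparse.normSq) d N →
      ReLUSparse.HasSparseCertificate A B C D f fmin d N :=
  ⟨ReLUSparse.exists_hasSphereCertificate hI hmin,
    fun _ _ hd h => h.hasSparseCertificate hf hd⟩
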